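/- Let $r,p\ge 1$, let $f\in\mathbb{R}^{r\times p}$, let $Q\in\mathbb{R}^{r\times r}$ and $S\in\mathbb{R}^{p\times p}$ be symmetric positive definite, let $N=\mathrm{diag}(n_1,\dots,n_p)$ with all $n_i>0$, and let $v\in\mathbb{R}$ be such that the density (1) below has finite total mass, that is, $2v+\mathrm{tr}(N)/p>2p$. Write $|\cdot|$ for the determinant and $\mathrm{etr}(\cdot)=\exp(\mathrm{tr}(\cdot))$. A random $p\times p$ matrix $\Sigma$ follows the modified inverted Wishart distribution $MIW_p(S,N,v)$ if it is almost surely symmetric positive definite and has, with respect to $d\Sigma=\prod_{i\le j}d\sigma_{ij}$ on the cone of positive definite matrices, a density proportional to $$|\Sigma|^{-\{v+\mathrm{tr}(N)/(2p)\}}\,\mathrm{etr}\left(-\tfrac12 N^{1/2}SN^{1/2}\Sigma^{-1}\right).\qquad(1)$$ For a positive definite $\Sigma$, the matrix normal distribution $N_{r\times p}(f,Q,\Sigma)$ is the law of an $r\times p$ random matrix $Y$ whose column-stacked vector $\mathrm{vec}(Y)$ is Gaussian with mean $\mathrm{vec}(f)$ and covariance matrix $\Sigma\otimes Q$. There is a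 constant $c>0$, depending only on $r,p,f,Q,S,N,v$, such that the following holds. If $\Sigma\sim MIW_p(S,N,v)$ and the conditional distribution of the $r\times p$ random matrix $Y$ given $\Sigma$ is $N_{r\times p}(f,Q,\Sigma)$, then the marginal distribution of $Y$ is absolutely continuous with respect to Lebesgue measure on $\mathbb{R}^{r\times p}$, with density $$p(Y)=c\,\left|N^{1/2}SN^{1/2}+(Y-f)'Q^{-1}(Y-f)\right|^{-\{2v+\mathrm{tr}(N)/p+r-p-1\}/2}.$$ (This distribution is called the modified matrix $t$ distribution $MT(f,Q,S,N,v)$.) -/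

import Mathlib

open MeasureTheory ProbabilityTheory

/-- Real matrices carry the product σ-algebra of their entries. -/
instance Matrix.instMeasurableSpaceReal {m n : Type*} : MeasurableSpace (Matrix m n ℝ) :=
  inferInstanceAs (MeasurableSpace (m → n → ℝ))

/-- The product σ-algebra on finite real matrices is standard Borel. -/
instance Matrix.instStandardBorelSpaceReal {m n : Type*} [Fintype m] [Fintype n] :
    StandardBorelSpace (Matrix m n ℝ) :=
  inferInstanceAs (StandardBorelSpace (m → n → ℝ))

namespace ModifiedWishart

/-- Lebesgue measure `∏ᵢⱼ dyᵢⱼ` on the space of `r × p` real matrices. -/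
noncomputable def matrixLebesgue (r p : ℕ) : Measure (Matrix (Fin r) (Fin p) ℝ) :=
  (volume : Measure (Fin r → Fin p → ℝ)).map Matrix.of

/-- The positions on and above the diagonal of a `p × p` matrix. -/
abbrev UpperIdx (p : ℕ) : Type := {ij : Fin p × Fin p // ij.1 ≤ ij.2}

/-- The symmetric matrix with prescribed entries on and above the diagonal. -/
def symMatrix {p : ℕ} (x : UpperIdx p → ℝ) : Matrix (Fin p) (Fin p) ℝ :=
  Matrix.of fun i j => x ⟨(min i j, max i j), min_le_max⟩

/-- The measure `dΣ = ∏_{i ≤ j} dσᵢⱼ`, carried by the symmetric `p × p` matrices. -/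
noncomputable def symLebesgue (p : ℕ) : Measure (Matrix (Fin p) (Fin p) ℝ) :=
  (volume : Measure (UpperIdx p → ℝ)).map symMatrix

/-- The matrix `N^{1/2} S N^{1/2}`, where `N = diag(n₁, …, n_p)`. -/
noncomputable def scaleMatrix {p : ℕ} (S : Matrix (Fin p) (Fin p) ℝ) (n : Fin p → ℝ) :
    Matrix (Fin p) (Fin p) ℝ :=
  Matrix.diagonal (fun i => √(n i)) * S * Matrix.diagonal (fun i => √(n i))

/-- The unnormalized density
`|Σ|^{-{v + tr(N)/(2p)}} etr(-½ N^{1/2} S N^{1/2} Σ⁻¹)`, where `N = diag(n₁, …, n_p)`. -/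
noncomputable def miwWeight {p : ℕ} (S : Matrix (Fin p) (Fin p) ℝ) (n : Fin p → ℝ) (v : ℝ)
    (σ : Matrix (Fin p) (Fin p) ℝ) : ℝ :=
  σ.det ^ (-(v + (Matrix.diagonal n).trace / (2 * (p : ℝ)))) *
    Real.exp ((-(1 / 2 : ℝ) • (scaleMatrix S n * σ⁻¹)).trace)

/-- The measure with density `miwWeight S n v` on the cone of positive definite matrices. -/
noncomputable def miwUnnormalized {p : ℕ} (S : Matrix (Fin p) (Fin p) ℝ) (n : Fin p → ℝ)
    (v : ℝ) : Measure (Matrix (Fin p) (Fin p) ℝ) :=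
  ((symLebesgue p).restrict {σ | σ.PosDef}).withDensity
    fun σ => ENNReal.ofReal (miwWeight S n v σ)

/-- The modified inverted Wishart distribution `MIW_p(S, N, v)` with `N = diag(n₁, …, n_p)`:
the density `miwWeight S n v` on the positive definite cone, divided by its total mass.
If the total mass is infinite this is the zero measure, which is the law of no random matrix. -/
noncomputable def modifiedInvertedWishart {p : ℕ} (S : Matrix (Fin p) (Fin p) ℝ)
    (n : Fin p → ℝ) (v : ℝ) : Measure (Matrix (Fin p) (Fin p) ℝ) :=
  (miwUnnormalized S n v Set.univ)⁻¹ • miwUnnormalized S n v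

/-- The matrix normal distribution `N_{r×p}(f, Q, Σ)`: the law of the `r × p` random matrix `Y`
for which `vec Y` (columns stacked) is Gaussian with mean `vec f` and covariance `Σ ⊗ Q`. -/
noncomputable def matrixNormal {r p : ℕ} (f : Matrix (Fin r) (Fin p) ℝ)
    (Q : Matrix (Fin r) (Fin r) ℝ) (σ : Matrix (Fin p) (Fin p) ℝ) :
    Measure (Matrix (Fin r) (Fin p) ℝ) :=
  (multivariateGaussian (WithLp.toLp 2 f.vec) (Matrix.kronecker σ Q)).map
    fun x => Matrix.of fun i j => x (j, i)

end ModifiedWishart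

namespace ModifiedWishart

/-! ### Jacobian of the congruence action on symmetric matrices. -/

section Congruence

open Matrix

variable {p : ℕ}

/-! The modified inverted Wishart law is conjugate to the matrix normal likelihood. The likelihood
contributes a factor $|\Sigma|^{-r/2}$ and adds $(Y-f)'Q^{-1}(Y-f)$ to the scale $N^{1/2}SN^{1/2}$,
so for fixed $Y$ the joint density is again a kernel $|\Sigma|^{-b}\,\mathrm{etr}(-\frac12
B\Sigma^{-1})$ with $B$ depending on $Y$ (`miwWeight_mul_matrixNormalPDF`). By Tonelli, integrating
out $\Sigma$ gives the marginal density.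

The cone integral of this kernel is a constant times $|B|^{(p+1)/2-b}$ (`coneIntegral_eq`):
substitute $\Sigma = B^{1/2}TB^{1/2}$ and use that $T\mapsto LTL'$ has Jacobian $|L|^{p+1}$ on
symmetric matrices (`det_symCongr`). With $b = v+\mathrm{tr}(N)/(2p)+r/2$ this is the stated
exponent.

The remaining constant is never evaluated as a multivariate gamma function. Since the law of $Y$ has
mass 1 and the unnormalized density is strictly positive, the constant can be neither $0$ nor
$\infty$. -/

lemma symMatrix_apply_of_le (x : UpperIdx p → ℝ) {i j : Fin p} (h : i ≤ j) :
    symMatrix x i j = x ⟨(i, j), h⟩ := by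
  simp [symMatrix, min_eq_left h, max_eq_right h]

lemma transpose_symMatrix (x : UpperIdx p → ℝ) : (symMatrix x)ᵀ = symMatrix x := by
  ext i j
  simp [symMatrix, min_comm, max_comm]

lemma symMatrix_upper {A : Matrix (Fin p) (Fin p) ℝ} (hA : Aᵀ = A) :
    symMatrix (fun ij : UpperIdx p => A ij.1.1 ij.1.2) = A := by
  ext i j
  rcases le_total i j with h | h
  · rw [symMatrix_apply_of_le _ h]
  · rw [← transpose_symMatrix, transpose_apply, symMatrix_apply_of_le _ h, ← hA, transpose_apply,
      hA]

/-- The action `x ↦ L x Lᵀ` of a matrix on symmetric matrices, in upper triangular coordinates. -/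
noncomputable def symCongr (L : Matrix (Fin p) (Fin p) ℝ) : Module.End ℝ (UpperIdx p → ℝ) where
  toFun x := fun ij => (L * symMatrix x * Lᵀ) ij.1.1 ij.1.2
  map_add' x y := by
    have : symMatrix (x + y) = symMatrix x + symMatrix y := by ext; simp [symMatrix]
    ext ij
    simp [this, Matrix.mul_add, Matrix.add_mul]
  map_smul' c x := by
    have : symMatrix (c • x) = c • symMatrix x := rfl
    ext ij
    rw [this, Matrix.mul_smul, Matrix.smul_mul]
    rfl

lemma symMatrix_symCongr (L : Matrix (Fin p) (Fin p) ℝ) (x : UpperIdx p → ℝ) :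
    symMatrix (symCongr L x) = L * symMatrix x * Lᵀ :=
  symMatrix_upper (A := L * symMatrix x * Lᵀ)
    (by simp [transpose_mul, transpose_symMatrix, Matrix.mul_assoc])

lemma symCongr_mul (A B : Matrix (Fin p) (Fin p) ℝ) :
    symCongr (A * B) = symCongr A * symCongr B := by
  refine LinearMap.ext fun x => funext fun ij => ?_
  change (A * B * symMatrix x * (A * B)ᵀ) ij.1.1 ij.1.2 =
    (A * symMatrix (symCongr B x) * Aᵀ) ij.1.1 ij.1.2
  rw [symMatrix_symCongr, transpose_mul]
  simp only [Matrix.mul_assoc]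

lemma symCongr_one : symCongr (1 : Matrix (Fin p) (Fin p) ℝ) = 1 := by
  refine LinearMap.ext fun x => funext fun ij => ?_
  change ((1 : Matrix (Fin p) (Fin p) ℝ) * symMatrix x * (1 : Matrix (Fin p) (Fin p) ℝ)ᵀ)
    ij.1.1 ij.1.2 = x ij
  rw [transpose_one, Matrix.one_mul, Matrix.mul_one, symMatrix_apply_of_le _ ij.2]

/-- Among the pairs $i\le j$, a given index $k$ (counted from 0) occurs $p-k$ times as first and
$k+1$ times as second coordinate, hence $p+1$ times in total. -/
lemma prod_upperIdx (d : Fin p → ℝ) :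
    ∏ ij : UpperIdx p, d ij.1.1 * d ij.1.2 = (∏ i, d i) ^ (p + 1) := by
  have key : ∀ F : Fin p × Fin p → ℝ,
      ∏ ij : UpperIdx p, F ij.1 = ∏ i, ∏ j, if i ≤ j then F (i, j) else 1 := by
    intro F
    rw [← Fintype.prod_prod_type' (fun i j => if i ≤ j then F (i, j) else 1),
      ← Finset.prod_filter]
    exact Finset.prod_subtype _ (by simp) _ |>.symm
  simp only [Finset.prod_mul_distrib, key (fun ij => d ij.1), key (fun ij => d ij.2)]
  rw [
    Finset.prod_comm (f := fun i j => if i ≤ j then d j else 1), ← Finset.prod_mul_distrib,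
    ← Finset.prod_pow]
  refine Finset.prod_congr rfl fun i _ => ?_
  rw [← Finset.prod_filter, ← Finset.prod_filter, Finset.filter_le_eq_Ici,
    Finset.filter_ge_eq_Iic, Finset.prod_const, Finset.prod_const, ← pow_add, Fin.card_Ici,
    Fin.card_Iic]
  congr 1
  omega

lemma det_symCongr_diagonal (d : Fin p → ℝ) :
    LinearMap.det (symCongr (diagonal d)) = (∏ i, d i) ^ (p + 1) := by
  rw [← prod_upperIdx, ← det_diagonal, ← LinearMap.det_toLin']
  congr 1
  refine LinearMap.ext fun x => funext fun ij => ?_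
  change (diagonal d * symMatrix x * (diagonal d)ᵀ) ij.1.1 ij.1.2 = _
  rw [diagonal_transpose, mul_diagonal, diagonal_mul, symMatrix_apply_of_le _ ij.2, toLin'_apply,
    mulVec_diagonal]
  ring

/-- With $D$ diagonal, equal to 2 at $i$ and 1 elsewhere, $DTD^{-1}=T^2$ for the transvection $T$. A
multiplicative map into the reals therefore satisfies $\chi(T)=\chi(T)^2$, and $\chi(T)\ne0$ because
$T$ is invertible. -/
lemma det_symCongr_transvection {i j : Fin p} (hij : i ≠ j) (c : ℝ) :
    LinearMap.det (symCongr (transvection i j c)) = 1 := by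
  set χ : Matrix (Fin p) (Fin p) ℝ → ℝ := fun A => LinearMap.det (symCongr A) with hχ
  have hmul : ∀ A B, χ (A * B) = χ A * χ B := fun A B => by simp [hχ, symCongr_mul]
  have hone : χ 1 = 1 := by simp [hχ, symCongr_one]
  let d : Fin p → ℝ := Function.update 1 i 2
  have hd : χ (diagonal d) ≠ 0 := by
    simp only [hχ, det_symCongr_diagonal]
    refine pow_ne_zero _ (Finset.prod_ne_zero_iff.2 fun k _ => ?_)
    by_cases hk : k = i <;> simp [d, hk]
  have hconj : diagonal d * transvection i j c =
      transvection i j c * transvection i j c * diagonal d := by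
    rw [transvection_mul_transvection_same _ _ hij]
    ext a b
    by_cases ha : a = i <;> by_cases hb : b = j <;>
      simp [transvection, d, Function.update_apply, single_apply, Matrix.add_apply, one_apply,
        ha, hb, hij.symm] <;>
      grind
  have hinv : χ (transvection i j c) * χ (transvection i j (-c)) = 1 := by
    rw [← hmul, transvection_mul_transvection_same _ _ hij]
    simp [hone]
  have h := congrArg χ hconj
  rw [hmul, hmul, hmul] at h
  have hne := left_ne_zero_of_mul_eq_one hinv
  change χ (transvection i j c) = 1
  have : (χ (transvection i j c) - 1) * (χ (transvection i j c) * χ (diagonal d)) = 0 := by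
    linear_combination -h
  rcases mul_eq_zero.1 this with h | h
  · linarith
  · exact absurd h (mul_ne_zero hne hd)

/-- The action of `L` on symmetric `p × p` matrices has determinant `|L| ^ (p + 1)`. -/
lemma det_symCongr (L : Matrix (Fin p) (Fin p) ℝ) :
    LinearMap.det (symCongr L) = L.det ^ (p + 1) := by
  -- Both sides are multiplicative in $L$, and every matrix is a product of diagonal matrices and
  -- transvections.
  refine diagonal_transvection_induction
    (fun A => LinearMap.det (symCongr A) = A.det ^ (p + 1)) L ?_ ?_ ?_
  · intro d _
    rw [det_symCongr_diagonal, det_diagonal]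
  · intro t
    rw [TransvectionStruct.toMatrix, det_symCongr_transvection t.hij,
      det_transvection_of_ne _ _ t.hij, one_pow]
  · intro A B hA hB
    rw [symCongr_mul, map_mul, hA, hB, det_mul, mul_pow]

end Congruence

/-! ### Measurability of inversion and of the positive definite cone. -/

section Measurability

open Matrix

instance borelSpace_matrix {m n : Type*} [Finite m] [Finite n] : BorelSpace (Matrix m n ℝ) := by
  cases nonempty_fintype m
  cases nonempty_fintype n
  exact inferInstanceAs (BorelSpace (m → n → ℝ))

lemma measurable_symMatrix {p : ℕ} : Measurable (symMatrix : (UpperIdx p → ℝ) → _) := by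
  refine measurable_pi_lambda _ fun i => measurable_pi_lambda _ fun j => ?_
  exact measurable_pi_apply _

lemma measurable_matrix_inv {p : ℕ} :
    Measurable (fun σ : Matrix (Fin p) (Fin p) ℝ => σ⁻¹) := by
  -- This also holds at singular matrices, where both sides are 0 by convention.
  have h : (fun σ : Matrix (Fin p) (Fin p) ℝ => σ⁻¹) = fun σ => σ.det⁻¹ • σ.adjugate := by
    funext σ
    rw [Matrix.inv_def, Ring.inverse_eq_inv']
  rw [h]
  exact (continuous_id.matrix_det.measurable.inv).smul continuous_id.matrix_adjugate.measurable

/-- The cone is the closed set of positive semidefinite matrices intersected with the open set of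
invertible ones. -/
lemma measurableSet_posDef {p : ℕ} :
    MeasurableSet {σ : Matrix (Fin p) (Fin p) ℝ | σ.PosDef} := by
  have h : {σ : Matrix (Fin p) (Fin p) ℝ | σ.PosDef} =
      ({σ | σᵀ = σ} ∩ ⋂ x : Fin p → ℝ, {σ | 0 ≤ x ⬝ᵥ σ *ᵥ x}) ∩ {σ | σ.det ≠ 0} := by
    ext σ
    have hsemi : σ.PosSemidef ↔ σᵀ = σ ∧ ∀ x : Fin p → ℝ, 0 ≤ x ⬝ᵥ σ *ᵥ x := by
      rw [posSemidef_iff_dotProduct_mulVec]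
      simp [IsHermitian, conjTranspose_eq_transpose_of_trivial]
    simp only [Set.mem_ofPred_eq, Set.mem_inter_iff, Set.mem_iInter, ← hsemi]
    exact ⟨fun h => ⟨h.posSemidef, h.det_pos.ne'⟩, fun h => h.1.posDef_iff_det_ne_zero.2 h.2⟩
  rw [h]
  refine ((IsClosed.inter ?_ ?_).measurableSet).inter ?_
  · exact isClosed_eq continuous_id.matrix_transpose continuous_id
  · exact isClosed_iInter fun x => isClosed_le continuous_const (by fun_prop)
  · exact (isOpen_ne_fun continuous_id.matrix_det continuous_const).measurableSet

end Measurability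

/-! ### Scaling of inverted Wishart integrals over the cone. -/

section ConeIntegral

open Matrix

variable {p : ℕ}

lemma map_symLebesgue_congr {L : Matrix (Fin p) (Fin p) ℝ} (hL : L.det ≠ 0) :
    (symLebesgue p).map (fun σ => L * σ * Lᵀ) =
      ENNReal.ofReal (|L.det| ^ (p + 1))⁻¹ • symLebesgue p := by
  have hdet : LinearMap.det (symCongr L) ≠ 0 := by
    rw [det_symCongr]
    exact pow_ne_zero _ hL
  have hmeas : Measurable fun σ : Matrix (Fin p) (Fin p) ℝ => L * σ * Lᵀ :=
    Continuous.measurable (by fun_prop)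
  rw [symLebesgue, Measure.map_map hmeas measurable_symMatrix]
  have : (fun σ => L * σ * Lᵀ) ∘ symMatrix = symMatrix ∘ symCongr L := by
    funext x
    exact (symMatrix_symCongr L x).symm
  rw [this, ← Measure.map_map measurable_symMatrix
    (LinearMap.continuous_of_finiteDimensional _).measurable,
    Measure.map_linearMap_addHaar_eq_smul_addHaar _ hdet, Measure.map_smul, det_symCongr, abs_inv,
    abs_pow]

/-- The integral of `|σ|^{-b} etr(-½ B σ⁻¹)` over the cone of positive definite matrices. -/
noncomputable def coneIntegral (b : ℝ) (B : Matrix (Fin p) (Fin p) ℝ) : ENNReal :=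
  ∫⁻ σ in {σ | σ.PosDef},
    ENNReal.ofReal (σ.det ^ (-b) * Real.exp (-(1 / 2) * (B * σ⁻¹).trace)) ∂symLebesgue p

lemma measurable_cone_integrand (b : ℝ) (B : Matrix (Fin p) (Fin p) ℝ) :
    Measurable fun σ : Matrix (Fin p) (Fin p) ℝ =>
      ENNReal.ofReal (σ.det ^ (-b) * Real.exp (-(1 / 2) * (B * σ⁻¹).trace)) := by
  have h1 : Measurable fun σ : Matrix (Fin p) (Fin p) ℝ => σ.det ^ (-b) :=
    (continuous_id.matrix_det.measurable).pow_const _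
  have h2 : Measurable fun σ : Matrix (Fin p) (Fin p) ℝ => (B * σ⁻¹).trace :=
    (show Continuous fun A : Matrix (Fin p) (Fin p) ℝ => (B * A).trace by fun_prop).measurable.comp
      measurable_matrix_inv
  exact (h1.mul (h2.const_mul _).exp).ennreal_ofReal

/-- Substitute $\sigma = L\tau L'$, which preserves the cone. The Jacobian gives $|\det L|^{p+1}$,
the determinant gives $(\det L)^{2(-b)}$, and the trace loses its dependence on $L$ by cyclicity. -/
lemma coneIntegral_mul_transpose (b : ℝ) {L : Matrix (Fin p) (Fin p) ℝ} (hL : L.det ≠ 0) :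
    coneIntegral b (L * Lᵀ) =
      ENNReal.ofReal (|L.det| ^ (p + 1) * (L.det ^ 2) ^ (-b)) * coneIntegral (p := p) b 1 := by
  have hpos : 0 < |L.det| ^ (p + 1) := pow_pos (abs_pos.2 hL) _
  have hUL : IsUnit L.det := isUnit_iff_ne_zero.2 hL
  have hULt : IsUnit Lᵀ.det := by rwa [det_transpose]
  have hmeas : Measurable fun σ : Matrix (Fin p) (Fin p) ℝ => L * σ * Lᵀ :=
    Continuous.measurable (by fun_prop)
  have hsym : symLebesgue p = ENNReal.ofReal (|L.det| ^ (p + 1)) •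
      (symLebesgue p).map (fun σ => L * σ * Lᵀ) := by
    rw [map_symLebesgue_congr hL, smul_smul, ← ENNReal.ofReal_mul hpos.le,
      mul_inv_cancel₀ hpos.ne', ENNReal.ofReal_one, one_smul]
  have hpd : ∀ σ : Matrix (Fin p) (Fin p) ℝ, (L * σ * Lᵀ).PosDef ↔ σ.PosDef := fun σ => by
    have := IsUnit.posDef_star_right_conjugate_iff (x := σ) ((isUnit_iff_isUnit_det L).2 hUL)
    simpa [star_eq_conjTranspose, conjTranspose_eq_transpose_of_trivial] using this
  rw [coneIntegral, hsym, Measure.restrict_smul, lintegral_smul_measure,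
    setLIntegral_map measurableSet_posDef (measurable_cone_integrand b _) hmeas]
  have hset : (fun σ => L * σ * Lᵀ) ⁻¹' {σ | σ.PosDef} = {σ : Matrix (Fin p) (Fin p) ℝ | σ.PosDef} :=
    Set.ext hpd
  rw [hset, ENNReal.ofReal_mul hpos.le, smul_eq_mul, mul_assoc, coneIntegral,
    ← lintegral_const_mul _ (measurable_cone_integrand b _)]
  congr 1
  refine setLIntegral_congr_fun measurableSet_posDef fun σ hσ => ?_
  have hdet : (L * σ * Lᵀ).det = L.det ^ 2 * σ.det := by
    rw [det_mul, det_mul, det_transpose]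
    ring
  have htr : (L * Lᵀ * (L * σ * Lᵀ)⁻¹).trace = (1 * σ⁻¹).trace := by
    rw [Matrix.mul_inv_rev, Matrix.mul_inv_rev, Matrix.mul_assoc L, ← Matrix.mul_assoc Lᵀ,
      mul_nonsing_inv _ hULt,
      Matrix.one_mul, trace_mul_comm, Matrix.mul_assoc, nonsing_inv_mul _ hUL, Matrix.mul_one,
      Matrix.one_mul]
  rw [hdet, htr, Real.mul_rpow (sq_nonneg _) (PosDef.det_pos hσ).le, mul_assoc,
    ENNReal.ofReal_mul (by positivity)]

open scoped MatrixOrder in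
/-- A positive definite matrix has a symmetric square root with determinant `√|B|`. -/
lemma exists_symm_sqrt {ι : Type*} [Fintype ι] [DecidableEq ι] {B : Matrix ι ι ℝ} (hB : B.PosDef) :
    (CFC.sqrt B)ᵀ = CFC.sqrt B ∧ CFC.sqrt B * CFC.sqrt B = B ∧ (CFC.sqrt B).det = √B.det := by
  refine ⟨?_, CFC.sqrt_mul_sqrt_self _ hB.posSemidef.nonneg, ?_⟩
  · have := (CFC.sqrt_nonneg B).isSelfAdjoint.star_eq
    rwa [star_eq_conjTranspose, conjTranspose_eq_transpose_of_trivial] at this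
  · have := hB.posSemidef.det_sqrt
    simpa using this

open scoped MatrixOrder in
-- Taking $L$ to be the symmetric square root of $B$, so that $\det L=|B|^{1/2}$, turns the Jacobian
-- into $|B|^{(p+1)/2}$. The identity lives in $[0,\infty]$, so no convergence condition is needed.
lemma coneIntegral_eq (b : ℝ) {B : Matrix (Fin p) (Fin p) ℝ} (hB : B.PosDef) :
    coneIntegral b B =
      ENNReal.ofReal (B.det ^ ((p + 1) / 2 - b)) * coneIntegral (p := p) b 1 := by
  obtain ⟨hT, hsq, hdet⟩ := exists_symm_sqrt hB
  have hpos := hB.det_pos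
  have hd : (CFC.sqrt B).det ≠ 0 := by
    rw [hdet]
    exact (Real.sqrt_pos.2 hpos).ne'
  have h := coneIntegral_mul_transpose b hd
  rw [hT, hsq, hdet, abs_of_nonneg (Real.sqrt_nonneg _), Real.sq_sqrt hpos.le, Real.sqrt_eq_rpow,
    ← Real.rpow_natCast, ← Real.rpow_mul hpos.le, ← Real.rpow_add hpos] at h
  rw [h]
  congr 3
  push_cast
  ring

end ConeIntegral

/-! ### Density of a nondegenerate multivariate Gaussian. -/

section Gaussian

open Matrix

variable {ι : Type*} [Fintype ι]

lemma pi_gaussianReal_eq_withDensity :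
    Measure.pi (fun _ : ι => gaussianReal 0 1) =
      volume.withDensity fun x => ENNReal.ofReal (∏ i, gaussianPDFReal 0 1 (x i)) := by
  refine Measure.pi_eq fun s hs => ?_
  have hg : ∀ i, Integrable ((s i).indicator (gaussianPDFReal 0 1)) volume := fun i =>
    (integrable_gaussianPDFReal 0 1).indicator (hs i)
  have hnn : ∀ i x, 0 ≤ (s i).indicator (gaussianPDFReal 0 1) x := fun i x =>
    Set.indicator_nonneg (fun y _ => gaussianPDFReal_nonneg 0 1 y) x
  -- On a box the cut-off density is a product of one-variable functions, so its integral
  -- factorizes; boxes determine the product measure.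
  have hind : (Set.univ.pi s).indicator
      (fun x : ι → ℝ => ENNReal.ofReal (∏ i, gaussianPDFReal 0 1 (x i))) =
      fun x => ENNReal.ofReal (∏ i, (s i).indicator (gaussianPDFReal 0 1) (x i)) := by
    classical
    funext x
    by_cases hx : x ∈ Set.univ.pi s
    · rw [Set.indicator_of_mem hx]
      congr 1
      exact Finset.prod_congr rfl fun i _ => (Set.indicator_of_mem (hx i trivial) _).symm
    · rw [Set.indicator_of_notMem hx]
      obtain ⟨i, hi⟩ : ∃ i, x i ∉ s i := by simpa [Set.mem_pi] using hx
      rw [Finset.prod_eq_zero (Finset.mem_univ i) (Set.indicator_of_notMem hi _),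
        ENNReal.ofReal_zero]
  have hint : Integrable
      (fun x : ι → ℝ => ∏ i, (s i).indicator (gaussianPDFReal 0 1) (x i)) volume :=
    Integrable.fintype_prod hg
  have hbox := MeasurableSet.univ_pi hs
  rw [withDensity_apply _ hbox, ← lintegral_indicator hbox, hind,
    ← ofReal_integral_eq_lintegral_ofReal hint
      (Filter.Eventually.of_forall fun x => Finset.prod_nonneg fun i _ => hnn i (x i)),
    integral_fintype_prod_volume_eq_prod,
    ENNReal.ofReal_prod_of_nonneg fun i _ => integral_nonneg (hnn i)]
  refine Finset.prod_congr rfl fun i _ => ?_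
  rw [gaussianReal_of_var_ne_zero 0 one_ne_zero, withDensity_apply _ (hs i),
    ofReal_integral_eq_lintegral_ofReal (hg i) (Filter.Eventually.of_forall (hnn i)),
    ← lintegral_indicator (hs i)]
  congr 1
  funext x
  by_cases hx : x ∈ s i <;> simp [hx, gaussianPDF]

lemma prod_gaussianPDFReal (x : ι → ℝ) :
    ∏ i, gaussianPDFReal 0 1 (x i) =
      (√(2 * Real.pi))⁻¹ ^ Fintype.card ι * Real.exp (-(1 / 2) * (x ⬝ᵥ x)) := by
  simp only [gaussianPDFReal, Finset.prod_mul_distrib, ← Real.exp_sum, dotProduct, Finset.mul_sum]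
  simp [sq, div_eq_inv_mul]

variable [DecidableEq ι]

/-- An affine bijection transports densities with the inverse Jacobian factor. -/
lemma map_affine_withDensity (m : ι → ℝ) {R : Matrix ι ι ℝ} (hR : R.det ≠ 0)
    {g : (ι → ℝ) → ENNReal} (hg : Measurable g) :
    (volume.withDensity g).map (fun x => m + R *ᵥ x) =
      volume.withDensity fun y => ENNReal.ofReal |R.det|⁻¹ * g (R⁻¹ *ᵥ (y - m)) := by
  have hT : Measurable fun x : ι → ℝ => m + R *ᵥ x := Continuous.measurable (by fun_prop)
  have hT' : Measurable fun y : ι → ℝ => R⁻¹ *ᵥ (y - m) := Continuous.measurable (by fun_prop)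
  have hvol : (volume : Measure (ι → ℝ)).map (fun x => m + R *ᵥ x) =
      ENNReal.ofReal |R.det|⁻¹ • volume := by
    have h := Real.map_matrix_volume_pi_eq_smul_volume_pi hR
    have hc : (fun x : ι → ℝ => m + R *ᵥ x) = (fun y => m + y) ∘ toLin' R := by
      funext x
      simp
    rw [hc, ← Measure.map_map (measurable_const_add m)
      (LinearMap.continuous_of_finiteDimensional _).measurable, h, Measure.map_smul,
      (measurePreserving_add_left volume m).map_eq, abs_inv]
  have hinv : ∀ x : ι → ℝ, R⁻¹ *ᵥ (m + R *ᵥ x - m) = x := fun x => by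
    rw [add_sub_cancel_left, mulVec_mulVec, nonsing_inv_mul _ (isUnit_iff_ne_zero.2 hR), one_mulVec]
  ext A hA
  rw [Measure.map_apply hT hA, withDensity_apply _ (hT hA), withDensity_apply _ hA,
    lintegral_const_mul (f := fun y => g (R⁻¹ *ᵥ (y - m))) _ (hg.comp hT'),
    ← smul_eq_mul, ← lintegral_smul_measure,
    ← Measure.restrict_smul, ← hvol,
    setLIntegral_map (f := fun y => g (R⁻¹ *ᵥ (y - m))) hA (hg.comp hT') hT]
  simp only [hinv]

open scoped MatrixOrder in
/-- The density of a nondegenerate multivariate Gaussian distribution. -/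
lemma map_ofLp_multivariateGaussian (m : EuclideanSpace ℝ ι) {M : Matrix ι ι ℝ} (hM : M.PosDef) :
    (multivariateGaussian m M).map WithLp.ofLp =
      volume.withDensity fun y => ENNReal.ofReal ((√(2 * Real.pi))⁻¹ ^ Fintype.card ι *
        (√M.det)⁻¹ * Real.exp (-(1 / 2) * ((y - m.ofLp) ⬝ᵥ M⁻¹ *ᵥ (y - m.ofLp)))) := by
  obtain ⟨hT, hsq, hdet⟩ := exists_symm_sqrt hM
  have hpos : 0 < √M.det := Real.sqrt_pos.2 hM.det_pos
  have hd : (CFC.sqrt M).det ≠ 0 := hdet ▸ hpos.ne'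
  have hcomp : (WithLp.ofLp ∘ fun x : EuclideanSpace ℝ ι =>
      m + toEuclideanCLM (𝕜 := ℝ) (CFC.sqrt M) x) ∘ WithLp.toLp 2 =
      fun x => m.ofLp + CFC.sqrt M *ᵥ x := by
    funext x
    simp
  have hmeas : Measurable fun x : ι → ℝ =>
      ENNReal.ofReal (∏ i, gaussianPDFReal 0 1 (x i)) := by
    refine (Finset.measurable_prod _ fun i _ => ?_).ennreal_ofReal
    exact (measurable_gaussianPDFReal 0 1).comp (measurable_pi_apply i)
  -- The Gaussian is the image of the standard one under $x\mapsto m+M^{1/2}x$, so the affine change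
  -- of variables applies.
  rw [multivariateGaussian, ← map_pi_eq_stdGaussian, Measure.map_map (by fun_prop) (by fun_prop),
    Measure.map_map (by fun_prop) (by fun_prop)]
  rw [hcomp, pi_gaussianReal_eq_withDensity, map_affine_withDensity _ hd hmeas]
  congr 1
  funext y
  rw [prod_gaussianPDFReal, ← ENNReal.ofReal_mul (by positivity), hdet, abs_of_pos hpos]
  have hquad : ((CFC.sqrt M)⁻¹ *ᵥ (y - m.ofLp)) ⬝ᵥ ((CFC.sqrt M)⁻¹ *ᵥ (y - m.ofLp)) =
      (y - m.ofLp) ⬝ᵥ M⁻¹ *ᵥ (y - m.ofLp) := by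
    conv_rhs => rw [← hsq, Matrix.mul_inv_rev, ← mulVec_mulVec, dotProduct_mulVec,
      ← mulVec_transpose, transpose_nonsing_inv, hT]
  rw [hquad]
  congr 1
  ring

end Gaussian

/-! ### Density of the matrix normal distribution. -/

section MatrixNormal

open Matrix
open scoped Kronecker

variable {r p : ℕ}

/-- Stacking columns only permutes and regroups coordinates, so it suffices to compare the measures
on boxes. -/
lemma map_unvec_volume :
    (volume : Measure (Fin p × Fin r → ℝ)).map
      (fun x => (Matrix.of fun i j => x (j, i) : Matrix (Fin r) (Fin p) ℝ)) =
      matrixLebesgue r p := by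
  have hvec : (volume : Measure (Fin r → Fin p → ℝ)).map (fun y (ji : Fin p × Fin r) => y ji.2 ji.1)
      = volume := by
    refine (Measure.pi_eq fun s hs => ?_).symm
    have hm : Measurable fun (y : Fin r → Fin p → ℝ) (ji : Fin p × Fin r) => y ji.2 ji.1 := by
      fun_prop
    have hpre : (fun (y : Fin r → Fin p → ℝ) (ji : Fin p × Fin r) => y ji.2 ji.1) ⁻¹'
        Set.univ.pi s = Set.univ.pi fun i => Set.univ.pi fun j => s (j, i) := by
      ext y
      simp only [Set.mem_preimage, Set.mem_pi, Set.mem_univ, true_implies, Prod.forall]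
      exact forall_comm
    rw [Measure.map_apply hm (MeasurableSet.univ_pi hs), hpre, volume_pi_pi]
    simp only [volume_pi_pi]
    rw [Finset.prod_comm, ← Fintype.prod_prod_type' (fun j i => volume (s (j, i)))]
  rw [← hvec, Measure.map_map]
  · rfl
  · exact measurable_pi_lambda _ fun i => measurable_pi_lambda _ fun j => measurable_pi_apply _
  · fun_prop

/-- The density of the matrix normal distribution `N_{r×p}(f, Q, σ)`. -/
noncomputable def matrixNormalPDF (f : Matrix (Fin r) (Fin p) ℝ) (Q : Matrix (Fin r) (Fin r) ℝ)
    (σ : Matrix (Fin p) (Fin p) ℝ) (y : Matrix (Fin r) (Fin p) ℝ) : ℝ :=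
  (√(2 * Real.pi))⁻¹ ^ (p * r) * (√(σ.det ^ r * Q.det ^ p))⁻¹ *
    Real.exp (-(1 / 2) * ((y - f)ᵀ * Q⁻¹ * (y - f) * σ⁻¹).trace)

lemma measurable_matrixNormalPDF (f : Matrix (Fin r) (Fin p) ℝ) (Q : Matrix (Fin r) (Fin r) ℝ) :
    Measurable fun z : Matrix (Fin p) (Fin p) ℝ × Matrix (Fin r) (Fin p) ℝ =>
      matrixNormalPDF f Q z.1 z.2 := by
  have h1 : Measurable fun z : Matrix (Fin p) (Fin p) ℝ × Matrix (Fin r) (Fin p) ℝ => z.1.det :=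
    continuous_id.matrix_det.measurable.comp measurable_fst
  have h2 : Measurable fun z : Matrix (Fin p) (Fin p) ℝ × Matrix (Fin r) (Fin p) ℝ =>
      ((z.2 - f)ᵀ * Q⁻¹ * (z.2 - f) * z.1⁻¹).trace := by
    have hA : Measurable fun y : Matrix (Fin r) (Fin p) ℝ => (y - f)ᵀ * Q⁻¹ * (y - f) :=
      Continuous.measurable (by fun_prop)
    have hentry : ∀ i j, Measurable fun A : Matrix (Fin p) (Fin p) ℝ => A i j := fun i j =>
      (measurable_pi_apply j).comp (measurable_pi_apply i)
    have htr : ∀ A B : Matrix (Fin p) (Fin p) ℝ, (A * B).trace = ∑ i, ∑ j, A i j * B j i :=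
      fun A B => by simp only [Matrix.trace, diag_apply, Matrix.mul_apply]
    simp only [htr _ (_⁻¹)]
    exact Finset.measurable_sum _ fun i _ => Finset.measurable_sum _ fun j _ =>
      ((hentry i j).comp (hA.comp measurable_snd)).mul
        ((hentry j i).comp (measurable_matrix_inv.comp measurable_fst))
  unfold matrixNormalPDF
  exact ((((h1.pow_const _).mul_const _).sqrt.inv).const_mul _).mul (h2.const_mul _).exp

lemma measurable_ofReal_matrixNormalPDF (f : Matrix (Fin r) (Fin p) ℝ)
    (Q : Matrix (Fin r) (Fin r) ℝ) (σ : Matrix (Fin p) (Fin p) ℝ) :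
    Measurable fun y => ENNReal.ofReal (matrixNormalPDF f Q σ y) :=
  ((measurable_matrixNormalPDF f Q).comp (measurable_const.prodMk measurable_id)).ennreal_ofReal

/-- The Gaussian density becomes a matrix formula through $|\sigma\otimes Q|=|\sigma|^r|Q|^p$ and
$(\sigma\otimes Q)^{-1}\mathrm{vec}(Z)=\mathrm{vec}(Q^{-1}Z\sigma^{-1})$, which turns the quadratic
form into $\mathrm{tr}(Z'Q^{-1}Z\sigma^{-1})$. -/
lemma matrixNormal_eq_withDensity (f : Matrix (Fin r) (Fin p) ℝ) {Q : Matrix (Fin r) (Fin r) ℝ}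
    (hQ : Q.PosDef) {σ : Matrix (Fin p) (Fin p) ℝ} (hσ : σ.PosDef) :
    matrixNormal f Q σ =
      (matrixLebesgue r p).withDensity fun y => ENNReal.ofReal (matrixNormalPDF f Q σ y) := by
  let U : (Fin p × Fin r → ℝ) → Matrix (Fin r) (Fin p) ℝ := fun x => Matrix.of fun i j => x (j, i)
  have hU : Measurable U :=
    measurable_pi_lambda _ fun i => measurable_pi_lambda _ fun j => measurable_pi_apply _
  have hpdf : Measurable fun y => ENNReal.ofReal (matrixNormalPDF f Q σ y) :=
    measurable_ofReal_matrixNormalPDF f Q σ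
  have hmap : matrixNormal f Q σ =
      ((multivariateGaussian (WithLp.toLp 2 f.vec) (σ ⊗ₖ Q)).map WithLp.ofLp).map U := by
    rw [Measure.map_map hU (by fun_prop)]
    rfl
  have hdens : ∀ x : Fin p × Fin r → ℝ, (√(2 * Real.pi))⁻¹ ^ Fintype.card (Fin p × Fin r) *
      (√(σ ⊗ₖ Q).det)⁻¹ *
        Real.exp (-(1 / 2) * ((x - f.vec) ⬝ᵥ (σ ⊗ₖ Q)⁻¹ *ᵥ (x - f.vec))) =
      matrixNormalPDF f Q σ (U x) := by
    intro x
    have hx : x - f.vec = (U x - f).vec := rfl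
    have hdet : (σ ⊗ₖ Q).det = σ.det ^ r * Q.det ^ p := by
      rw [det_kronecker]
      simp
    have hσT : (σ⁻¹)ᵀ = σ⁻¹ := by
      have := hσ.inv.isHermitian.eq
      rwa [conjTranspose_eq_transpose_of_trivial] at this
    rw [hdet, hx, inv_kronecker, kronecker_mulVec_vec, vec_dotProduct_vec, hσT, matrixNormalPDF]
    simp [Matrix.mul_assoc]
  rw [hmap, map_ofLp_multivariateGaussian _ (hσ.kronecker hQ), ← map_unvec_volume]
  simp only [hdens]
  ext A hA
  rw [Measure.map_apply hU hA, withDensity_apply _ (hU hA), withDensity_apply _ hA,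
    setLIntegral_map hA hpdf hU]

end MatrixNormal

/-! ### Integrating out the covariance matrix. -/

section Mixture

open Matrix

variable {r p : ℕ}

instance sFinite_symLebesgue : SFinite (symLebesgue p) := by
  unfold symLebesgue
  infer_instance

instance sFinite_matrixLebesgue : SFinite (matrixLebesgue r p) := by
  unfold matrixLebesgue
  infer_instance

/-- Used to show that a strictly positive density has nonzero mass, which rules out an infinite
normalizing constant. -/
lemma matrixLebesgue_univ_ne_zero : matrixLebesgue r p Set.univ ≠ 0 := by
  have hm : Measurable (Matrix.of : (Fin r → Fin p → ℝ) → Matrix (Fin r) (Fin p) ℝ) :=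
    measurable_id
  rw [matrixLebesgue, Measure.map_apply hm MeasurableSet.univ, Set.preimage_univ]
  exact isOpen_univ.measure_ne_zero _ Set.univ_nonempty

lemma scaleMatrix_posDef {S : Matrix (Fin p) (Fin p) ℝ} {n : Fin p → ℝ} (hS : S.PosDef)
    (hn : ∀ i, 0 < n i) : (scaleMatrix S n).PosDef := by
  have hU : IsUnit (diagonal fun i => √(n i)) := by
    rw [isUnit_iff_isUnit_det, det_diagonal, isUnit_iff_ne_zero]
    exact Finset.prod_ne_zero_iff.2 fun i _ => (Real.sqrt_pos.2 (hn i)).ne'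
  have := (IsUnit.posDef_star_right_conjugate_iff (x := S) hU).2 hS
  rwa [star_eq_conjTranspose, conjTranspose_eq_transpose_of_trivial, diagonal_transpose] at this

/-- The matrix `N^{1/2} S N^{1/2} + (y - f)ᵀ Q⁻¹ (y - f)`. -/
noncomputable def posteriorScale (f : Matrix (Fin r) (Fin p) ℝ) (Q : Matrix (Fin r) (Fin r) ℝ)
    (S : Matrix (Fin p) (Fin p) ℝ) (n : Fin p → ℝ) (y : Matrix (Fin r) (Fin p) ℝ) :
    Matrix (Fin p) (Fin p) ℝ :=
  scaleMatrix S n + (y - f)ᵀ * Q⁻¹ * (y - f)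

lemma posteriorScale_posDef (f : Matrix (Fin r) (Fin p) ℝ) {Q : Matrix (Fin r) (Fin r) ℝ}
    {S : Matrix (Fin p) (Fin p) ℝ} {n : Fin p → ℝ} (hQ : Q.PosDef) (hS : S.PosDef)
    (hn : ∀ i, 0 < n i) (y : Matrix (Fin r) (Fin p) ℝ) : (posteriorScale f Q S n y).PosDef := by
  have := hQ.inv.posSemidef.conjTranspose_mul_mul_same (y - f)
  rw [conjTranspose_eq_transpose_of_trivial] at this
  exact (scaleMatrix_posDef hS hn).add_posSemidef this

lemma measurable_miwWeight (S : Matrix (Fin p) (Fin p) ℝ) (n : Fin p → ℝ) (v : ℝ) :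
    Measurable fun σ => ENNReal.ofReal (miwWeight S n v σ) := by
  have := measurable_cone_integrand (v + (diagonal n).trace / (2 * (p : ℝ))) (scaleMatrix S n)
  simpa only [miwWeight, trace_smul, smul_eq_mul] using this

/-- The part of the matrix normal normalizing constant that does not depend on `σ`. -/
noncomputable def normalConst (r p : ℕ) (Q : Matrix (Fin r) (Fin r) ℝ) : ℝ :=
  (√(2 * Real.pi))⁻¹ ^ (p * r) * (√(Q.det ^ p))⁻¹

/-- Conjugacy: the exponents of $|\sigma|$ add, and the two traces against $\sigma^{-1}$ merge into
one with the updated scale. -/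
lemma miwWeight_mul_matrixNormalPDF (f : Matrix (Fin r) (Fin p) ℝ) {Q : Matrix (Fin r) (Fin r) ℝ}
    (S : Matrix (Fin p) (Fin p) ℝ) (n : Fin p → ℝ) (v : ℝ) {σ : Matrix (Fin p) (Fin p) ℝ}
    (hσ : σ.PosDef) (y : Matrix (Fin r) (Fin p) ℝ) :
    miwWeight S n v σ * matrixNormalPDF f Q σ y =
      normalConst r p Q * (σ.det ^ (-(v + (diagonal n).trace / (2 * (p : ℝ)) + r / 2)) *
        Real.exp (-(1 / 2) * (posteriorScale f Q S n y * σ⁻¹).trace)) := by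
  have hpos := hσ.det_pos
  have hsqrt : (√(σ.det ^ r * Q.det ^ p))⁻¹ = σ.det ^ (-(r / 2 : ℝ)) * (√(Q.det ^ p))⁻¹ := by
    rw [Real.sqrt_mul (pow_nonneg hpos.le _), mul_inv, Real.sqrt_eq_rpow, ← Real.rpow_natCast,
      ← Real.rpow_mul hpos.le, Real.rpow_neg hpos.le]
    ring_nf
  rw [miwWeight, matrixNormalPDF, normalConst, posteriorScale, hsqrt,
    neg_add (v + (diagonal n).trace / (2 * (p : ℝ))), Real.rpow_add hpos,
    Matrix.add_mul, trace_add, mul_add, Real.exp_add, trace_smul, smul_eq_mul]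
  ring

/-- The law of the matrix normal mixture, up to its normalizing constant. -/
lemma lintegral_matrixNormal_miwUnnormalized (f : Matrix (Fin r) (Fin p) ℝ)
    {Q : Matrix (Fin r) (Fin r) ℝ} {S : Matrix (Fin p) (Fin p) ℝ} {n : Fin p → ℝ} (v : ℝ)
    (hQ : Q.PosDef) (hS : S.PosDef) (hn : ∀ i, 0 < n i) {A : Set (Matrix (Fin r) (Fin p) ℝ)}
    (hA : MeasurableSet A) :
    ∫⁻ σ, matrixNormal f Q σ A ∂(miwUnnormalized S n v) =
      ∫⁻ y in A, ENNReal.ofReal (normalConst r p Q) *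
        (ENNReal.ofReal ((posteriorScale f Q S n y).det ^
          ((p + 1) / 2 - (v + (diagonal n).trace / (2 * (p : ℝ)) + r / 2))) *
          coneIntegral (p := p) (v + (diagonal n).trace / (2 * (p : ℝ)) + r / 2) 1)
        ∂(matrixLebesgue r p) := by
  have hk : 0 ≤ normalConst r p Q := by
    unfold normalConst
    positivity
  have hw := measurable_miwWeight S n v
  have hpdf : Measurable fun z : Matrix (Fin p) (Fin p) ℝ × Matrix (Fin r) (Fin p) ℝ =>
      ENNReal.ofReal (matrixNormalPDF f Q z.1 z.2) := (measurable_matrixNormalPDF f Q).ennreal_ofReal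
  have hint : Measurable fun σ : Matrix (Fin p) (Fin p) ℝ =>
      ∫⁻ y in A, ENNReal.ofReal (matrixNormalPDF f Q σ y) ∂(matrixLebesgue r p) :=
    hpdf.lintegral_prod_right'
  -- The density formula for the matrix normal law is available only for positive definite $\sigma$,
  -- and the mixing measure is carried by these.
  have hpd : ∀ᵐ σ ∂(miwUnnormalized S n v), σ.PosDef :=
    (withDensity_absolutelyContinuous _ _).ae_le (ae_restrict_mem measurableSet_posDef)
  have hnormal : ∀ᵐ σ ∂(miwUnnormalized S n v), matrixNormal f Q σ A =
      ∫⁻ y in A, ENNReal.ofReal (matrixNormalPDF f Q σ y) ∂(matrixLebesgue r p) := by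
    filter_upwards [hpd] with σ hσ
    rw [matrixNormal_eq_withDensity f hQ hσ, withDensity_apply _ hA]
  rw [lintegral_congr_ae hnormal, miwUnnormalized, lintegral_withDensity_eq_lintegral_mul _ hw hint]
  simp only [Pi.mul_apply, ← lintegral_const_mul _ (measurable_ofReal_matrixNormalPDF f Q _)]
  -- Tonelli: for fixed $y$ the inner integral over $\sigma$ is then a cone integral with scale
  -- `posteriorScale f Q S n y`.
  rw [lintegral_lintegral_swap ((hw.comp measurable_fst).mul hpdf).aemeasurable]
  refine lintegral_congr fun y => ?_
  rw [← coneIntegral_eq _ (posteriorScale_posDef f hQ hS hn y), coneIntegral,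
    ← lintegral_const_mul _ (measurable_cone_integrand _ _)]
  refine setLIntegral_congr_fun measurableSet_posDef fun σ hσ => ?_
  have hw0 : 0 ≤ miwWeight S n v σ :=
    mul_nonneg (Real.rpow_nonneg (PosDef.det_pos hσ).le _) (Real.exp_nonneg _)
  change ENNReal.ofReal (miwWeight S n v σ) * ENNReal.ofReal (matrixNormalPDF f Q σ y) = _
  rw [← ENNReal.ofReal_mul hw0, miwWeight_mul_matrixNormalPDF f S n v hσ y,
    ENNReal.ofReal_mul hk]

/-- The normalizing constant of the modified matrix `t` distribution. -/
noncomputable def matrixTConst (r : ℕ) {p : ℕ} (Q : Matrix (Fin r) (Fin r) ℝ)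
    (S : Matrix (Fin p) (Fin p) ℝ) (n : Fin p → ℝ) (v : ℝ) : ENNReal :=
  (miwUnnormalized S n v Set.univ)⁻¹ * (ENNReal.ofReal (normalConst r p Q) *
    coneIntegral (p := p) (v + (diagonal n).trace / (2 * (p : ℝ)) + r / 2) 1)

lemma measurable_det_posteriorScale (f : Matrix (Fin r) (Fin p) ℝ) (Q : Matrix (Fin r) (Fin r) ℝ)
    (S : Matrix (Fin p) (Fin p) ℝ) (n : Fin p → ℝ) (e : ℝ) :
    Measurable fun y => ENNReal.ofReal ((posteriorScale f Q S n y).det ^ e) := by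
  have : Continuous fun y => (posteriorScale f Q S n y).det := by
    unfold posteriorScale
    fun_prop
  exact (this.measurable.pow_const _).ennreal_ofReal

lemma lintegral_matrixNormal_modifiedInvertedWishart (f : Matrix (Fin r) (Fin p) ℝ)
    {Q : Matrix (Fin r) (Fin r) ℝ} {S : Matrix (Fin p) (Fin p) ℝ} {n : Fin p → ℝ} (v : ℝ)
    (hQ : Q.PosDef) (hS : S.PosDef) (hn : ∀ i, 0 < n i) {A : Set (Matrix (Fin r) (Fin p) ℝ)}
    (hA : MeasurableSet A) :
    ∫⁻ σ, matrixNormal f Q σ A ∂(modifiedInvertedWishart S n v) =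
      matrixTConst r Q S n v * ∫⁻ y in A, ENNReal.ofReal ((posteriorScale f Q S n y).det ^
        (-(2 * v + (diagonal n).trace / (p : ℝ) + r - p - 1) / 2)) ∂(matrixLebesgue r p) := by
  have he : ((p : ℝ) + 1) / 2 - (v + (diagonal n).trace / (2 * (p : ℝ)) + r / 2) =
      -(2 * v + (diagonal n).trace / (p : ℝ) + r - p - 1) / 2 := by ring
  rw [modifiedInvertedWishart, lintegral_smul_measure,
    lintegral_matrixNormal_miwUnnormalized f v hQ hS hn hA, he, matrixTConst, smul_eq_mul, mul_assoc,
    ← lintegral_const_mul _ (measurable_det_posteriorScale f Q S n _)]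
  congr 2
  funext y
  ring

/-- The marginal law of a matrix normal mixture over a modified inverted Wishart distribution. -/
lemma map_eq_matrixTConst_smul (f : Matrix (Fin r) (Fin p) ℝ)
    {Q : Matrix (Fin r) (Fin r) ℝ} {S : Matrix (Fin p) (Fin p) ℝ} {n : Fin p → ℝ} (v : ℝ)
    (hQ : Q.PosDef) (hS : S.PosDef) (hn : ∀ i, 0 < n i)
    {Ω : Type*} [MeasurableSpace Ω] (P : Measure Ω) [IsProbabilityMeasure P]
    (Y : Ω → Matrix (Fin r) (Fin p) ℝ) (Sg : Ω → Matrix (Fin p) (Fin p) ℝ)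
    (hY : AEMeasurable Y P) (hSg : HasLaw Sg (modifiedInvertedWishart S n v) P)
    (hYS : ∀ᵐ σ ∂(P.map Sg), condDistrib Y Sg P σ = matrixNormal f Q σ) :
    P.map Y = matrixTConst r Q S n v • (matrixLebesgue r p).withDensity fun y =>
      ENNReal.ofReal ((posteriorScale f Q S n y).det ^
        (-(2 * v + (diagonal n).trace / (p : ℝ) + r - p - 1) / 2)) := by
  ext A hA
  -- Law of total probability: the law of $Y$ is its conditional law averaged over the law of
  -- $\Sigma$.
  rw [← condDistrib_comp_map hSg.aemeasurable hY,
    Measure.bind_apply hA (Kernel.measurable _).aemeasurable,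
    lintegral_congr_ae (hYS.mono fun σ hσ => congrArg (fun μ => μ A) hσ), hSg.map_eq,
    lintegral_matrixNormal_modifiedInvertedWishart f v hQ hS hn hA, Measure.smul_apply,
    withDensity_apply _ hA, smul_eq_mul]

end Mixture

end ModifiedWishart

/-! ### The marginal law, with a positive finite constant. -/

theorem proposition2 {r p : ℕ} (f : Matrix (Fin r) (Fin p) ℝ) (Q : Matrix (Fin r) (Fin r) ℝ)
    (S : Matrix (Fin p) (Fin p) ℝ) (n : Fin p → ℝ) (v : ℝ)
    (hQ : Q.PosDef) (hS : S.PosDef) (hn : ∀ i, 0 < n i) :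
    ∃ c : ℝ, 0 < c ∧
      ∀ {Ω : Type*} [MeasurableSpace Ω] (P : Measure Ω) [IsProbabilityMeasure P]
        (Y : Ω → Matrix (Fin r) (Fin p) ℝ) (Sg : Ω → Matrix (Fin p) (Fin p) ℝ),
        AEMeasurable Y P →
        HasLaw Sg (ModifiedWishart.modifiedInvertedWishart S n v) P →
        (∀ᵐ σ ∂(P.map Sg), condDistrib Y Sg P σ = ModifiedWishart.matrixNormal f Q σ) →
        HasLaw Y
          ((ModifiedWishart.matrixLebesgue r p).withDensity fun y =>
            ENNReal.ofReal
              (c * (ModifiedWishart.scaleMatrix S n + (y - f).transpose * Q⁻¹ * (y - f)).det ^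
                (-(2 * v + (Matrix.diagonal n).trace / (p : ℝ) + r - p - 1) / 2))) P := by
  set C := ModifiedWishart.matrixTConst r Q S n v with hC
  have hpos : ∀ y, 0 < (ModifiedWishart.posteriorScale f Q S n y).det ^
      (-(2 * v + (Matrix.diagonal n).trace / (p : ℝ) + r - p - 1) / 2) := fun y =>
    Real.rpow_pos_of_pos (ModifiedWishart.posteriorScale_posDef f hQ hS hn y).det_pos _
  have hmeas := ModifiedWishart.measurable_det_posteriorScale f Q S n
    (-(2 * v + (Matrix.diagonal n).trace / (p : ℝ) + r - p - 1) / 2)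
  refine ⟨if C = 0 ∨ C = ⊤ then 1 else C.toReal, ?_, ?_⟩
  · split_ifs with h
    · exact one_pos
    · rw [not_or] at h
      exact ENNReal.toReal_pos h.1 h.2
  intro Ω _ P _ Y Sg hY hSg hYS
  have hlaw := ModifiedWishart.map_eq_matrixTConst_smul f v hQ hS hn P Y Sg hY hSg hYS
  rw [← hC] at hlaw
  have hprob := Measure.isProbabilityMeasure_map (μ := P) hY
  have hmass := hprob.measure_univ
  rw [hlaw, Measure.smul_apply, smul_eq_mul] at hmass
  -- Total mass 1 reads $C\cdot m=1$, with $m$ the mass of the unnormalized density. This fails for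
  -- $C=0$; it also fails for $C=\infty$, because $m\neq0$.
  have hne : ¬ (C = 0 ∨ C = ⊤) := by
    rintro (h | h)
    · simp [h] at hmass
    · have hzero : (ModifiedWishart.matrixLebesgue r p).withDensity (fun y => ENNReal.ofReal
          ((ModifiedWishart.posteriorScale f Q S n y).det ^
            (-(2 * v + (Matrix.diagonal n).trace / (p : ℝ) + r - p - 1) / 2))) Set.univ ≠ 0 := by
        rw [withDensity_apply _ MeasurableSet.univ, Measure.restrict_univ, Ne,
          lintegral_eq_zero_iff hmeas]
        intro h0
        refine ModifiedWishart.matrixLebesgue_univ_ne_zero (r := r) (p := p) ?_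
        rw [Measure.measure_univ_eq_zero, ← ae_eq_bot, ← Filter.eventually_false_iff_eq_bot]
        filter_upwards [h0] with y hy
        exact (ENNReal.ofReal_pos.2 (hpos y)).ne' hy
      rw [h, ENNReal.top_mul hzero] at hmass
      exact ENNReal.top_ne_one hmass
  refine ⟨hY, ?_⟩
  rw [hlaw, if_neg hne, ← withDensity_smul _ hmeas]
  rw [not_or] at hne
  congr 1
  funext y
  rw [ENNReal.ofReal_mul ENNReal.toReal_nonneg, ENNReal.ofReal_toReal hne.2]
  rfl
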